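/- Let $F$ be a field of characteristic $2$, let $V$ be a finite dimensional vector space over $F$, and let $q : V \to F$ be a quadratic form whose polar form $\mathfrak{b}_q(u,v)=q(u+v)-q(u)-q(v)$ is nondegenerate. Let $\tau$ be an isometry of $(V,q)$ with $\tau^2=\mathrm{id}$, and let $J_\tau$ be the unique involution (an $F$-linear antiautomorphism with $J_\tau^2=\mathrm{id}$) of the Clifford algebra $C(q)$ with $J_\tau(v)=\tau(v)$ for all $v\in V$. Then $(C(q),J_\tau)$ is totally decomposable, i.e. there are an integer $n\ge 0$ and quaternion algebras with involution $(Q_1,\sigma_1),\dots,(Q_n,\sigma_n)$ over $F$ (each $Q_i$ a central simple $F$-algebra of dimension $4$, each $\sigma_i$ an $F$-linear antiautomorphism of $Q_i$ with $\sigma_i^2=\mathrm{id}$) such that $$(C(q),J_\tau)\simeq (Q_1,\sigma_1)\otimes_F\cdots\otimes_F(Q_n,\sigma_n)$$ as $F$-algebras with involution, where the empty tensor product ($n=0$) is $(F,\mathrm{id})$. -/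

import Mathlib

open scoped TensorProduct

universe u v w

/-- An involution (of the first kind) on an `F`-algebra `A`: an `F`-linear antiautomorphism of `A`
whose square is the identity. -/
structure AlgInvolution (F : Type u) (A : Type w) [Field F] [Ring A] [Algebra F A] where
  /-- The underlying `F`-linear map. -/
  toLinearMap : A →ₗ[F] A
  map_one' : toLinearMap 1 = 1
  map_mul' : ∀ a b : A, toLinearMap (a * b) = toLinearMap b * toLinearMap a
  involutive' : ∀ a : A, toLinearMap (toLinearMap a) = a

/-- The tensor product over `F` of a family of involutions: it sends `⨂ aᵢ` to `⨂ σᵢ(aᵢ)`. -/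
noncomputable def AlgInvolution.piTensor {F : Type u} [Field F] {ι : Type*} {A : ι → Type w}
    [∀ i, Ring (A i)] [∀ i, Algebra F (A i)] (σ : ∀ i, AlgInvolution F (A i)) :
    AlgInvolution F (⨂[F] i, A i) where
  toLinearMap := PiTensorProduct.map fun i => (σ i).toLinearMap
  map_one' := by
    rw [PiTensorProduct.one_def, PiTensorProduct.map_tprod]
    congr 1
    funext i
    exact (σ i).map_one'
  map_mul' a b := by
    induction a using PiTensorProduct.induction_on with
    | add x y hx hy => rw [add_mul, map_add, hx, hy, map_add, mul_add]
    | smul_tprod r x =>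
      induction b using PiTensorProduct.induction_on with
      | add x y hx hy => rw [mul_add, map_add, hx, hy, map_add, add_mul]
      | smul_tprod s y =>
        rw [smul_mul_smul_comm, map_smul, map_smul, map_smul, smul_mul_smul_comm, mul_comm r s,
          PiTensorProduct.tprod_mul_tprod, PiTensorProduct.map_tprod, PiTensorProduct.map_tprod,
          PiTensorProduct.map_tprod, PiTensorProduct.tprod_mul_tprod]
        congr 2
        funext i
        exact (σ i).map_mul' _ _
  involutive' a := by
    induction a using PiTensorProduct.induction_on with
    | add x y hx hy => rw [map_add, map_add, hx, hy]
    | smul_tprod r x =>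
      rw [map_smul, map_smul, PiTensorProduct.map_tprod, PiTensorProduct.map_tprod]
      congr 2
      funext i
      exact (σ i).involutive' _

/-- A quaternion algebra with involution over `F`: a central simple `F`-algebra of degree `2`,
that is of dimension `4`, with an involution of the first kind. -/
structure QuaternionAlgebraWithInvolution (F : Type u) [Field F] where
  /-- The underlying type. -/
  carrier : Type w
  [ring : Ring carrier]
  [algebra : Algebra F carrier]
  [isCentral : Algebra.IsCentral F carrier]
  [isSimple : IsSimpleRing carrier]
  finrank_eq_four : Module.finrank F carrier = 4
  /-- The involution. -/
  inv : AlgInvolution F carrier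

attribute [instance] QuaternionAlgebraWithInvolution.ring QuaternionAlgebraWithInvolution.algebra

/-- `(A, σ)` is totally decomposable: it is isomorphic, as an `F`-algebra with involution, to the
tensor product over `F` of a finite family of quaternion algebras with involution. The empty tensor
product is `F` with the identity. -/
def AlgInvolution.IsTotallyDecomposable {F : Type u} {A : Type w} [Field F] [Ring A] [Algebra F A]
    (σ : AlgInvolution F A) : Prop :=
  ∃ (n : ℕ) (Q : Fin n → QuaternionAlgebraWithInvolution.{u, w} F)
    (e : A ≃ₐ[F] ⨂[F] i, (Q i).carrier),
    ∀ a : A, e (σ.toLinearMap a) =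
      (AlgInvolution.piTensor fun i => (Q i).inv).toLinearMap (e a)

section CliffordInvolution

variable {F : Type u} {V : Type v} [Field F] [AddCommGroup V] [Module F V] {q : QuadraticForm F V}

/-- The involution `J_τ` of the Clifford algebra `C(q)` induced by an isometry `τ` of `q` with
`τ² = id`. It is the only involution with `J_τ(v) = τ(v)` for `v ∈ V`, see
`cliffordInvolution_ι` and `cliffordInvolution_unique`. -/
noncomputable def cliffordInvolution (τ : q.IsometryEquiv q) (hτ : ∀ x, τ (τ x) = x) :
    AlgInvolution F (CliffordAlgebra q) where
  toLinearMap :=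
    CliffordAlgebra.reverse ∘ₗ (CliffordAlgebra.map τ.toIsometry).toLinearMap
  map_one' := by simp
  map_mul' a b := by simp [CliffordAlgebra.reverse.map_mul]
  involutive' a := by
    induction a using CliffordAlgebra.induction with
    | algebraMap r => simp [CliffordAlgebra.reverse.commutes]
    | ι x => simp [hτ]
    | mul a b ha hb =>
      simp only [LinearMap.comp_apply, AlgHom.toLinearMap_apply, map_mul,
        CliffordAlgebra.reverse.map_mul] at ha hb ⊢
      rw [ha, hb]
    | add a b ha hb => rw [map_add, map_add, ha, hb]

theorem cliffordInvolution_ι (τ : q.IsometryEquiv q) (hτ : ∀ x, τ (τ x) = x) (x : V) :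
    (cliffordInvolution τ hτ).toLinearMap (CliffordAlgebra.ι q x) = CliffordAlgebra.ι q (τ x) := by
  simp [cliffordInvolution]

theorem cliffordInvolution_unique (τ : q.IsometryEquiv q) (hτ : ∀ x, τ (τ x) = x)
    (σ : AlgInvolution F (CliffordAlgebra q))
    (hσ : ∀ x, σ.toLinearMap (CliffordAlgebra.ι q x) = CliffordAlgebra.ι q (τ x)) :
    σ = cliffordInvolution τ hτ := by
  have key : ∀ a, σ.toLinearMap a = (cliffordInvolution τ hτ).toLinearMap a := fun a => by
    induction a using CliffordAlgebra.induction with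
    | algebraMap r =>
      rw [Algebra.algebraMap_eq_smul_one, map_smul, map_smul, σ.map_one',
        (cliffordInvolution τ hτ).map_one']
    | ι x => rw [hσ, cliffordInvolution_ι]
    | mul a b ha hb => rw [σ.map_mul', (cliffordInvolution τ hτ).map_mul', ha, hb]
    | add a b ha hb => rw [map_add, map_add, ha, hb]
  have h := LinearMap.ext key
  cases σ
  cases hJ : cliffordInvolution τ hτ
  simp_all

end CliffordInvolution

/-! The proof splits `V` into small nondegenerate `τ`-stable orthogonal summands. In characteristic
2, orthogonal vectors commute in `C(q)`, so the summands generate commuting `J_τ`-stable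
subalgebras, and each of these is shown to be generated by one or two commuting stable quaternion
subalgebras. The induction (`IsNondegenerateStable.isQuaternionGenerated`) runs over nondegenerate
stable subspaces `U`.

If some `x` has `b(x, τx) ≠ 0`, then `x` and `τx` span a stable nondegenerate plane, which generates
a quaternion algebra. If `τ` is the identity on `U`, any nondegenerate plane will do. In the
remaining case `N = 1 + τ` is nonzero with totally singular image, and a hyperbolic 4-space `x, y,
Nx, Ny` splits off. Its Clifford algebra need not be cut along stable planes; explicit
non-homogeneous elements give two commuting stable quaternion pairs
(`IsHyperbolicQuadruple.relations`).

Finally, commuting stable quaternion subalgebras generating the algebra give a surjection from their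
tensor product, injective by a dimension count (`IsQuaternionFamily.isTotallyDecomposable`). -/

theorem module_add_self (F : Type u) {V : Type v} [Field F] [AddCommGroup V] [Module F V]
    [CharP F 2] (x : V) : x + x = 0 := by
  rw [← two_smul F x, CharTwo.two_eq_zero, zero_smul]

/-! ### Quaternion algebras generated by a pair `u, v` -/

/-- `u` and `v` satisfy the relations of a symplectic basis of a binary quadratic space inside its
Clifford algebra. -/
structure IsQuaternionPair (F : Type u) {A : Type w} [Field F] [Ring A] [Algebra F A]
    (u v : A) : Prop where
  sq_left : ∃ a : F, u * u = algebraMap F A a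
  sq_right : ∃ b : F, v * v = algebraMap F A b
  anticomm : u * v + v * u = 1

namespace IsQuaternionPair

variable {F : Type u} {A : Type w} [Field F] [Ring A] [Algebra F A] {u v : A}

/-- The span of `1, u, v, uv` is stable under left multiplication by `u` and `v`, hence by all of
the algebra they generate; applying this to `1` gives the result. -/
theorem mem_adjoin_iff (h : IsQuaternionPair F u v) (x : A) :
    x ∈ Algebra.adjoin F {u, v} ↔
      ∃ a b c d : F, x = algebraMap F A a + algebraMap F A b * u + algebraMap F A c * v
        + algebraMap F A d * (u * v) := by
  obtain ⟨α, hα⟩ := h.sq_left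
  obtain ⟨β, hβ⟩ := h.sq_right
  have hvu : v * u = 1 - u * v := eq_sub_of_add_eq' h.anticomm
  have huu (x : A) : u * (u * x) = α • x := by rw [← mul_assoc, hα, Algebra.smul_def]
  have hvux (x : A) : v * (u * x) = x - u * (v * x) := by
    rw [← mul_assoc, hvu, sub_mul, one_mul, mul_assoc]
  constructor
  · intro hx
    suffices H : ∀ y : A, (∃ a b c d : F, y = algebraMap F A a + algebraMap F A b * u
        + algebraMap F A c * v + algebraMap F A d * (u * v)) →
        ∃ a b c d : F, x * y = algebraMap F A a + algebraMap F A b * u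
        + algebraMap F A c * v + algebraMap F A d * (u * v) by
      simpa using H 1 ⟨1, 0, 0, 0, by simp⟩
    induction hx using Algebra.adjoin_induction with
    | mem x hx =>
      rintro y ⟨a, b, c, d, rfl⟩
      rcases hx with rfl | rfl
      · refine ⟨α * b, a, α * d, c, ?_⟩
        simp only [Algebra.algebraMap_eq_smul_one, mul_add, mul_smul_comm, smul_mul_assoc, one_mul,
          mul_one, huu, hα]
        module
      · refine ⟨b + β * c, -(β * d), a + d, -b, ?_⟩
        simp only [Algebra.algebraMap_eq_smul_one, mul_add, mul_smul_comm, smul_mul_assoc, one_mul,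
          mul_one, hvux, hvu, hβ]
        module
    | algebraMap r =>
      rintro y ⟨a, b, c, d, rfl⟩
      exact ⟨r * a, r * b, r * c, r * d, by simp only [mul_add, map_mul, mul_assoc]⟩
    | add x₁ x₂ _ _ h₁ h₂ =>
      intro y hy
      obtain ⟨a, b, c, d, h₁⟩ := h₁ y hy
      obtain ⟨a', b', c', d', h₂⟩ := h₂ y hy
      refine ⟨a + a', b + b', c + c', d + d', ?_⟩
      rw [add_mul, h₁, h₂]
      simp only [map_add, add_mul]
      abel
    | mul x₁ x₂ _ _ h₁ h₂ =>
      intro y hy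
      rw [mul_assoc]
      exact h₁ _ (h₂ y hy)
  · rintro ⟨a, b, c, d, rfl⟩
    have hu : u ∈ Algebra.adjoin F {u, v} := Algebra.subset_adjoin (by simp)
    have hv : v ∈ Algebra.adjoin F {u, v} := Algebra.subset_adjoin (by simp)
    have hs (r : F) : algebraMap F A r ∈ Algebra.adjoin F {u, v} := Subalgebra.algebraMap_mem _ r
    exact add_mem (add_mem (add_mem (hs a) (mul_mem (hs b) hu)) (mul_mem (hs c) hv))
      (mul_mem (hs d) (mul_mem hu hv))

/-- Coordinates with respect to `1`, `u`, `v`, `u * v`, with coefficients in a subalgebra. -/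
def coordMap (u v : A) (B : Subalgebra F A) : (Fin 4 → B) →ₗ[F] A where
  toFun p := p 0 + p 1 * u + p 2 * v + p 3 * (u * v)
  map_add' p p' := by simp only [Pi.add_apply, Subalgebra.coe_add, add_mul]; abel
  map_smul' r p := by simp [smul_add]

variable [CharP F 2]

/-- In characteristic 2, `z ↦ uz + zu` is the commutator, a derivation with `u ↦ 0` and `v ↦ 1`. It
acts as differentiation in `v`; its companion `comm_right` differentiates in `u`. Together they
extract the coefficients of an element. -/
theorem comm_left (h : IsQuaternionPair F u v) {a b c d : A} (ha : Commute u a) (hb : Commute u b)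
    (hc : Commute u c) (hd : Commute u d) :
    u * (a + b * u + c * v + d * (u * v)) + (a + b * u + c * v + d * (u * v)) * u = c + d * u := by
  have e (x : A) : x + x = 0 := module_add_self F x
  have key : u * (a + b * u + c * v + d * (u * v)) + (a + b * u + c * v + d * (u * v)) * u
      = (a * u + a * u) + (b * u * u + b * u * u) + c * (u * v + v * u)
        + d * u * (u * v + v * u) := by
    simp only [mul_add, add_mul, ← mul_assoc, ha.eq, hb.eq, hc.eq, hd.eq]
    abel
  rw [key, e, e, h.anticomm]
  simp

theorem comm_right (h : IsQuaternionPair F u v) {a b c d : A} (ha : Commute v a) (hb : Commute v b)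
    (hc : Commute v c) (hd : Commute v d) :
    v * (a + b * u + c * v + d * (u * v)) + (a + b * u + c * v + d * (u * v)) * v = b + d * v := by
  have e (x : A) : x + x = 0 := module_add_self F x
  have key : v * (a + b * u + c * v + d * (u * v)) + (a + b * u + c * v + d * (u * v)) * v
      = (a * v + a * v) + (c * v * v + c * v * v) + b * (u * v + v * u)
        + d * (u * v + v * u) * v := by
    simp only [mul_add, add_mul, ← mul_assoc, ha.eq, hb.eq, hc.eq, hd.eq]
    abel
  rw [key, e, e, h.anticomm]
  simp

theorem comm_right_right (h : IsQuaternionPair F u v) {b d : A} (hb : Commute u b)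
    (hd : Commute u d) : u * (b + d * v) + (b + d * v) * u = d := by
  have e (x : A) : x + x = 0 := module_add_self F x
  have key : u * (b + d * v) + (b + d * v) * u = (b * u + b * u) + d * (u * v + v * u) := by
    simp only [mul_add, add_mul, ← mul_assoc, hb.eq, hd.eq]
    abel
  rw [key, e, h.anticomm]
  simp

/-- `1`, `u`, `v`, `u * v` are independent over the centralizer of `u` and `v`. -/
theorem eq_zero_of_sum_eq_zero (h : IsQuaternionPair F u v) {a b c d : A}
    (hu : ∀ x ∈ ({a, b, c, d} : Set A), Commute u x)
    (hv : ∀ x ∈ ({a, b, c, d} : Set A), Commute v x)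
    (h0 : a + b * u + c * v + d * (u * v) = 0) : a = 0 ∧ b = 0 ∧ c = 0 ∧ d = 0 := by
  have h1 := h.comm_left (hu a (by simp)) (hu b (by simp)) (hu c (by simp)) (hu d (by simp))
  have h2 := h.comm_right (hv a (by simp)) (hv b (by simp)) (hv c (by simp)) (hv d (by simp))
  rw [h0] at h1 h2
  have h3 := h.comm_right_right (hu b (by simp)) (hu d (by simp))
  rw [← h2] at h3
  obtain rfl : d = 0 := by simpa using h3.symm
  obtain rfl : b = 0 := by simpa using h2.symm
  obtain rfl : c = 0 := by simpa using h1.symm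
  simpa using h0

theorem coordMap_injective (h : IsQuaternionPair F u v) {B : Subalgebra F A}
    (hu : ∀ b ∈ B, Commute u b) (hv : ∀ b ∈ B, Commute v b) :
    Function.Injective (coordMap u v B) := by
  rw [injective_iff_map_eq_zero]
  intro p hp
  obtain ⟨h0, h1, h2, h3⟩ := h.eq_zero_of_sum_eq_zero (a := p 0) (b := p 1) (c := p 2) (d := p 3)
    (by rintro x (rfl | rfl | rfl | rfl) <;> exact hu _ (Subtype.prop _))
    (by rintro x (rfl | rfl | rfl | rfl) <;> exact hv _ (Subtype.prop _)) hp
  funext i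
  fin_cases i <;> exact Subtype.ext ‹_›

theorem four_mul_finrank_le [FiniteDimensional F A] (h : IsQuaternionPair F u v)
    {B : Subalgebra F A} (hu : ∀ b ∈ B, Commute u b) (hv : ∀ b ∈ B, Commute v b) :
    4 * Module.finrank F B ≤ Module.finrank F (Algebra.adjoin F {u, v} ⊔ B : Subalgebra F A) := by
  have hle : LinearMap.range (coordMap u v B) ≤
      Subalgebra.toSubmodule (Algebra.adjoin F {u, v} ⊔ B) := by
    rintro _ ⟨p, rfl⟩
    have hB (i : Fin 4) : (p i : A) ∈ Algebra.adjoin F {u, v} ⊔ B :=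
      (le_sup_right : B ≤ _) (p i).2
    have hu : u ∈ Algebra.adjoin F {u, v} ⊔ B :=
      (le_sup_left : Algebra.adjoin F {u, v} ≤ _) (Algebra.subset_adjoin (by simp))
    have hv : v ∈ Algebra.adjoin F {u, v} ⊔ B :=
      (le_sup_left : Algebra.adjoin F {u, v} ≤ _) (Algebra.subset_adjoin (by simp))
    change _ ∈ Algebra.adjoin F {u, v} ⊔ B
    exact add_mem (add_mem (add_mem (hB 0) (mul_mem (hB 1) hu)) (mul_mem (hB 2) hv))
      (mul_mem (hB 3) (mul_mem hu hv))
  have h1 := LinearMap.finrank_range_of_inj (h.coordMap_injective hu hv)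
  rw [Module.finrank_pi_fintype] at h1
  have h2 := Submodule.finrank_mono hle
  simp only [Finset.sum_const, Finset.card_univ, Fintype.card_fin, smul_eq_mul] at h1
  rw [h1] at h2
  exact h2

theorem finrank_adjoin [Nontrivial A] (h : IsQuaternionPair F u v) :
    Module.finrank F (Algebra.adjoin F {u, v}) = 4 := by
  have hc (x : A) : ∀ b ∈ (⊥ : Subalgebra F A), Commute x b := by
    intro b hb
    obtain ⟨r, rfl⟩ := Algebra.mem_bot.mp hb
    exact (Algebra.commutes r x).symm
  have h1 := LinearMap.finrank_range_of_inj (h.coordMap_injective (hc u) (hc v))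
  have h2 : LinearMap.range (coordMap u v (⊥ : Subalgebra F A)) =
      Subalgebra.toSubmodule (Algebra.adjoin F {u, v}) := by
    ext x
    rw [Subalgebra.mem_toSubmodule, h.mem_adjoin_iff]
    constructor
    · rintro ⟨p, rfl⟩
      obtain ⟨a, ha⟩ := Algebra.mem_bot.mp (p 0).2
      obtain ⟨b, hb⟩ := Algebra.mem_bot.mp (p 1).2
      obtain ⟨c, hc⟩ := Algebra.mem_bot.mp (p 2).2
      obtain ⟨d, hd⟩ := Algebra.mem_bot.mp (p 3).2
      exact ⟨a, b, c, d, by rw [ha, hb, hc, hd]; rfl⟩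
    · rintro ⟨a, b, c, d, rfl⟩
      exact ⟨![algebraMap F _ a, algebraMap F _ b, algebraMap F _ c, algebraMap F _ d], rfl⟩
  rw [h2, Module.finrank_pi_fintype] at h1
  simpa [Subalgebra.finrank_bot] using h1

/-- Both derivations kill a central element, which forces every coefficient but the constant one to
vanish. -/
theorem isCentral_adjoin (h : IsQuaternionPair F u v) :
    Algebra.IsCentral F (Algebra.adjoin F {u, v}) where
  out := by
    intro x hx
    rw [Subalgebra.mem_center_iff] at hx
    have hu := congrArg Subtype.val (hx ⟨u, Algebra.subset_adjoin (by simp)⟩)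
    have hv := congrArg Subtype.val (hx ⟨v, Algebra.subset_adjoin (by simp)⟩)
    obtain ⟨a, b, c, d, hd⟩ := (h.mem_adjoin_iff _).mp x.2
    have cm (x : A) (r : F) : Commute x (algebraMap F A r) := (Algebra.commutes r x).symm
    have h1 := h.comm_left (cm u a) (cm u b) (cm u c) (cm u d)
    have h2 := h.comm_right (cm v a) (cm v b) (cm v c) (cm v d)
    simp only [MulMemClass.coe_mul] at hu hv
    rw [← hd, hu, module_add_self F] at h1
    rw [← hd, hv, module_add_self F] at h2
    have h3 := h.comm_right_right (cm u b) (cm u d)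
    rw [← h2, mul_zero, zero_mul, add_zero] at h3
    rw [← h3, zero_mul, add_zero] at h1 h2
    rw [← h1, ← h2, ← h3] at hd
    exact Algebra.mem_bot.mpr ⟨a, Subtype.ext (by simpa using hd.symm)⟩

/-- Ideals are stable under commutators, so a nonzero element can be differentiated down to a
nonzero scalar in the ideal. -/
theorem isSimpleRing_adjoin [Nontrivial A] (h : IsQuaternionPair F u v) :
    IsSimpleRing (Algebra.adjoin F {u, v}) := by
  refine IsSimpleRing.of_eq_bot_or_eq_top fun I => or_iff_not_imp_left.mpr fun hI => ?_
  have hscal (r : F) (hr : r ≠ 0) (hm : algebraMap F (Algebra.adjoin F {u, v}) r ∈ I) : I = ⊤ := by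
    rw [← TwoSidedIdeal.one_mem_iff]
    have := I.mul_mem_left (algebraMap F _ r⁻¹) _ hm
    rwa [← map_mul, inv_mul_cancel₀ hr, map_one] at this
  let U : Algebra.adjoin F {u, v} := ⟨u, Algebra.subset_adjoin (by simp)⟩
  let W : Algebra.adjoin F {u, v} := ⟨v, Algebra.subset_adjoin (by simp)⟩
  obtain ⟨x, hxI, hx0⟩ : ∃ x ∈ I, x ≠ 0 := by
    by_contra! H
    exact hI (le_bot_iff.mp fun x hx => (TwoSidedIdeal.mem_bot _).mpr (H x hx))
  obtain ⟨a, b, c, d, hd⟩ := (h.mem_adjoin_iff _).mp x.2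
  have cm (x : A) (r : F) : Commute x (algebraMap F A r) := (Algebra.commutes r x).symm
  have h1 := h.comm_left (cm u a) (cm u b) (cm u c) (cm u d)
  have h2 := h.comm_right (cm v a) (cm v b) (cm v c) (cm v d)
  have h3 := h.comm_right_right (cm u b) (cm u d)
  have hbr (y z : Algebra.adjoin F {u, v}) (hz : z ∈ I) : y * z + z * y ∈ I :=
    I.add_mem (I.mul_mem_left _ _ hz) (I.mul_mem_right _ _ hz)
  by_cases hd0 : d = 0
  · subst hd0
    by_cases hc0 : c = 0
    · subst hc0
      by_cases hb0 : b = 0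
      · subst hb0
        have ha0 : a ≠ 0 := by
          rintro rfl
          exact hx0 (Subtype.ext (by simpa using hd))
        refine hscal a ha0 ?_
        convert hxI
        exact Subtype.ext (by simpa using hd.symm)
      · refine hscal b hb0 ?_
        convert hbr W x hxI
        refine Subtype.ext ?_
        rw [← hd] at h2
        simpa using h2.symm
    · refine hscal c hc0 ?_
      convert hbr U x hxI
      refine Subtype.ext ?_
      rw [← hd] at h1
      simpa using h1.symm
  · refine hscal d hd0 ?_
    convert hbr U _ (hbr W x hxI)
    refine Subtype.ext ?_
    rw [← h2, ← hd] at h3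
    exact h3.symm

end IsQuaternionPair

/-! ### Restricting involutions, and involutions on tensor factors -/

namespace AlgInvolution

variable {F : Type u} {A : Type w} [Field F] [Ring A] [Algebra F A]

/-- An involution as an algebra homomorphism to the opposite algebra. -/
def toOpHom (σ : AlgInvolution F A) : A →ₐ[F] Aᵐᵒᵖ :=
  AlgHom.ofLinearMap ((MulOpposite.opLinearEquiv F).toLinearMap ∘ₗ σ.toLinearMap)
    (by simp [σ.map_one']) (fun a b => by simp [σ.map_mul'])

theorem map_mem_adjoin (σ : AlgInvolution F A) {s : Set A} {B : Subalgebra F A}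
    (h : ∀ x ∈ s, σ.toLinearMap x ∈ B) {x : A} (hx : x ∈ Algebra.adjoin F s) :
    σ.toLinearMap x ∈ B := by
  induction hx using Algebra.adjoin_induction with
  | mem x hx => exact h x hx
  | algebraMap r =>
    rw [Algebra.algebraMap_eq_smul_one, map_smul, σ.map_one']
    exact B.smul_mem B.one_mem r
  | add x y _ _ hx hy => rw [map_add]; exact add_mem hx hy
  | mul x y _ _ hx hy => rw [σ.map_mul']; exact mul_mem hy hx

/-- The restriction of an involution to a stable subalgebra. -/
def restrict (σ : AlgInvolution F A) (B : Subalgebra F A)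
    (h : ∀ x ∈ B, σ.toLinearMap x ∈ B) : AlgInvolution F B where
  toLinearMap := σ.toLinearMap.restrict (p := Subalgebra.toSubmodule B)
    (q := Subalgebra.toSubmodule B) h
  map_one' := Subtype.ext σ.map_one'
  map_mul' a b := Subtype.ext (σ.map_mul' a b)
  involutive' a := Subtype.ext (σ.involutive' a)

theorem piTensor_singleAlgHom {ι : Type*} [DecidableEq ι] {A : ι → Type w} [∀ i, Ring (A i)]
    [∀ i, Algebra F (A i)] (σ : ∀ i, AlgInvolution F (A i)) (i : ι) (x : A i) :
    (piTensor σ).toLinearMap (PiTensorProduct.singleAlgHom (R := F) i x) =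
      PiTensorProduct.singleAlgHom (R := F) i ((σ i).toLinearMap x) := by
  change PiTensorProduct.map _ (PiTensorProduct.tprod F (Pi.mulSingle i x)) =
    PiTensorProduct.tprod F (Pi.mulSingle i ((σ i).toLinearMap x))
  rw [PiTensorProduct.map_tprod]
  congr 1
  funext j
  exact Pi.apply_mulSingle (fun j => (σ j).toLinearMap) (fun j => (σ j).map_one') i x j

end AlgInvolution

/-! ### Maps from a tensor product into an algebra with commuting subalgebras -/

section LiftCommuting

variable {F : Type u} [Field F] {A : Type*} [Ring A] [Algebra F A] {n : ℕ} {S : Fin n → Type*}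
  [∀ i, Ring (S i)] [∀ i, Algebra F (S i)] (φ : ∀ i, S i →ₐ[F] A)
  (hφ : Pairwise fun i j => ∀ x y, Commute (φ i x) (φ j y))

/-- The product of the values of algebra homomorphisms with commuting images. -/
noncomputable def commutingProd : (∀ i, S i) →* A :=
  MonoidHom.noncommPiCoprod (fun i => (φ i : S i →* A)) hφ

theorem commutingProd_mulSingle (i : Fin n) (x : S i) :
    commutingProd φ hφ (Pi.mulSingle i x) = φ i x :=
  MonoidHom.noncommPiCoprod_mulSingle _ _ _

/-- Isolating one factor on the left reduces multilinearity to linearity of `φ i`. -/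
theorem commutingProd_update (m : ∀ i, S i) (i : Fin n) (x : S i) :
    commutingProd φ hφ (Function.update m i x) =
      φ i x * commutingProd φ hφ (Function.update m i 1) := by
  have : Function.update m i x = Pi.mulSingle i x * Function.update m i 1 := by
    funext j
    by_cases h : j = i
    · subst h; simp
    · simp [h]
  rw [this, map_mul, commutingProd_mulSingle]

/-- The algebra homomorphism from a tensor product induced by homomorphisms with commuting
images. -/
noncomputable def piTensorLift : (⨂[F] i, S i) →ₐ[F] A :=
  PiTensorProduct.liftAlgHom
    { toFun := commutingProd φ hφ
      map_update_add' := by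
        intro inst m i x y
        obtain rfl : inst = instDecidableEqFin n := Subsingleton.elim _ _
        rw [commutingProd_update, commutingProd_update φ hφ m i x,
          commutingProd_update φ hφ m i y, map_add, add_mul]
      map_update_smul' := by
        intro inst m i r x
        obtain rfl : inst = instDecidableEqFin n := Subsingleton.elim _ _
        rw [commutingProd_update, commutingProd_update φ hφ m i x, map_smul, smul_mul_assoc] }
    (map_one (commutingProd φ hφ)) (map_mul (commutingProd φ hφ))

theorem piTensorLift_single (i : Fin n) (x : S i) :
    piTensorLift φ hφ (PiTensorProduct.singleAlgHom i x) = φ i x := by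
  change piTensorLift φ hφ (PiTensorProduct.tprod F (Pi.mulSingle i x)) = φ i x
  rw [piTensorLift, PiTensorProduct.liftAlgHom_apply, PiTensorProduct.lift.tprod]
  exact commutingProd_mulSingle φ hφ i x

/-- Read as homomorphisms into the opposite algebra, both sides are determined by their values on
the single tensor factors. -/
theorem piTensorLift_involution (σ : ∀ i, AlgInvolution F (S i)) (J : AlgInvolution F A)
    (hJ : ∀ i x, J.toLinearMap (φ i x) = φ i ((σ i).toLinearMap x)) (t : ⨂[F] i, S i) :
    J.toLinearMap (piTensorLift φ hφ t) =
      piTensorLift φ hφ ((AlgInvolution.piTensor σ).toLinearMap t) := by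
  have key : J.toOpHom.comp (piTensorLift φ hφ) =
      (AlgHom.op (piTensorLift φ hφ)).comp (AlgInvolution.piTensor σ).toOpHom := by
    refine PiTensorProduct.algHom_ext fun i => AlgHom.ext fun x => ?_
    apply MulOpposite.unop_injective
    change J.toLinearMap (piTensorLift φ hφ (PiTensorProduct.singleAlgHom i x)) =
      piTensorLift φ hφ ((AlgInvolution.piTensor σ).toLinearMap (PiTensorProduct.singleAlgHom i x))
    rw [AlgInvolution.piTensor_singleAlgHom, piTensorLift_single, piTensorLift_single, hJ]
  exact congrArg MulOpposite.unop (DFunLike.congr_fun key t)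

end LiftCommuting

/-! ### Commuting families of quaternion pairs and total decomposability -/

theorem commute_of_mem_adjoin_of_mem_adjoin {F : Type u} {A : Type w} [Field F] [Ring A]
    [Algebra F A] {s t : Set A} (h : ∀ x ∈ s, ∀ y ∈ t, Commute x y) {x y : A}
    (hx : x ∈ Algebra.adjoin F s) (hy : y ∈ Algebra.adjoin F t) : Commute x y :=
  Algebra.commute_of_mem_adjoin_of_forall_mem_commute hy fun z hz =>
    (Algebra.commute_of_mem_adjoin_of_forall_mem_commute hx fun w hw => (h w hw z hz).symm).symm

/-- A family of mutually commuting quaternion pairs, each spanning a `J`-stable subalgebra. -/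
structure IsQuaternionFamily {F : Type u} {A : Type w} [Field F] [Ring A] [Algebra F A]
    (J : AlgInvolution F A) {n : ℕ} (u v : Fin n → A) : Prop where
  pair (i : Fin n) : IsQuaternionPair F (u i) (v i)
  inv_mem (i : Fin n) : ∀ x ∈ ({u i, v i} : Set A),
    J.toLinearMap x ∈ Algebra.adjoin F {u i, v i}
  commute : Pairwise fun i j => ∀ x ∈ ({u i, v i} : Set A), ∀ y ∈ ({u j, v j} : Set A), Commute x y

namespace IsQuaternionFamily

variable {F : Type u} {A : Type w} [Field F] [Ring A] [Algebra F A]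
  {J : AlgInvolution F A}

theorem tail {n : ℕ} {u v : Fin (n + 1) → A} (h : IsQuaternionFamily J u v) :
    IsQuaternionFamily J (Fin.tail u) (Fin.tail v) where
  pair i := h.pair i.succ
  inv_mem i := h.inv_mem i.succ
  commute _ _ hij := h.commute (Fin.succ_injective _ |>.ne hij)

theorem cons {n : ℕ} {u v : Fin n → A} (h : IsQuaternionFamily J u v) {a b : A}
    (hab : IsQuaternionPair F a b)
    (hJ : ∀ x ∈ ({a, b} : Set A), J.toLinearMap x ∈ Algebra.adjoin F {a, b})
    (hc : ∀ i, ∀ x ∈ ({a, b} : Set A), ∀ y ∈ ({u i, v i} : Set A), Commute x y) :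
    IsQuaternionFamily J (Fin.cons a u : Fin (n + 1) → A) (Fin.cons b v : Fin (n + 1) → A) where
  pair := Fin.cases hab h.pair
  inv_mem := Fin.cases hJ h.inv_mem
  commute := by
    intro i j
    refine Fin.cases ?_ (fun i => ?_) i <;> refine Fin.cases ?_ (fun j => ?_) j
    · exact fun h => absurd rfl h
    · exact fun _ => hc j
    · exact fun _ x hx y hy => (hc i y hy x hx).symm
    · exact fun hij => h.commute (fun e => hij (congrArg Fin.succ e))

/-- The algebra generated by the later pairs centralizes the first pair, so adjoining that pair
multiplies the dimension by at least 4. -/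
theorem four_pow_le_finrank [CharP F 2] [FiniteDimensional F A] [Nontrivial A] {n : ℕ}
    {u v : Fin n → A} (h : IsQuaternionFamily J u v) :
    4 ^ n ≤ Module.finrank F (Algebra.adjoin F (⋃ i, ({u i, v i} : Set A))) := by
  induction n with
  | zero =>
    rw [pow_zero]
    exact Module.finrank_pos
  | succ n ih =>
    have hU : (⋃ i, ({u i, v i} : Set A)) =
        {u 0, v 0} ∪ ⋃ i, ({Fin.tail u i, Fin.tail v i} : Set A) := by
      ext x
      simp [Fin.exists_fin_succ, Fin.tail]
    have hc : ∀ x ∈ ({u 0, v 0} : Set A),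
        ∀ y ∈ Algebra.adjoin F (⋃ i, ({Fin.tail u i, Fin.tail v i} : Set A)), Commute x y :=
      fun x hx y hy => commute_of_mem_adjoin_of_mem_adjoin
        (fun x hx y hy => by
          obtain ⟨i, hi⟩ := Set.mem_iUnion.mp hy
          exact h.commute (Fin.succ_ne_zero i).symm x hx y hi)
        (Algebra.subset_adjoin hx) hy
    rw [hU, Algebra.adjoin_union, pow_succ']
    exact (Nat.mul_le_mul_left 4 (ih h.tail)).trans
      ((h.pair 0).four_mul_finrank_le (hc _ (by simp)) (hc _ (by simp)))

/-- The multiplication map from the tensor product is onto because the pairs generate `A`. Its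
source has dimension `4 ^ n`, and `four_pow_le_finrank` bounds the target below by the same number.
-/
theorem isTotallyDecomposable [CharP F 2] [Nontrivial A] {n : ℕ} {u v : Fin n → A}
    (h : IsQuaternionFamily J u v)
    (htop : Algebra.adjoin F (⋃ i, ({u i, v i} : Set A)) = ⊤) : J.IsTotallyDecomposable := by
  let S (i : Fin n) : Subalgebra F A := Algebra.adjoin F {u i, v i}
  have hS (i : Fin n) : ∀ x ∈ S i, J.toLinearMap x ∈ S i := fun x hx =>
    J.map_mem_adjoin (h.inv_mem i) hx
  let Q (i : Fin n) : QuaternionAlgebraWithInvolution.{u, w} F :=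
    { carrier := S i
      isCentral := (h.pair i).isCentral_adjoin
      isSimple := (h.pair i).isSimpleRing_adjoin
      finrank_eq_four := (h.pair i).finrank_adjoin
      inv := J.restrict (S i) (hS i) }
  let φ (i : Fin n) : (Q i).carrier →ₐ[F] A := (S i).val
  have hφ : Pairwise fun i j => ∀ x y, Commute (φ i x) (φ j y) := fun i j hij x y =>
    commute_of_mem_adjoin_of_mem_adjoin (h.commute hij) x.2 y.2
  let f := piTensorLift φ hφ
  have hsurj : Function.Surjective f := by
    rw [← AlgHom.range_eq_top, ← top_le_iff, ← htop, Algebra.adjoin_le_iff]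
    intro x hx
    obtain ⟨i, hi⟩ := Set.mem_iUnion.mp hx
    exact ⟨_, piTensorLift_single φ hφ i ⟨x, Algebra.subset_adjoin hi⟩⟩
  have hfin (i : Fin n) : FiniteDimensional F (Q i).carrier :=
    FiniteDimensional.of_finrank_pos (by rw [(Q i).finrank_eq_four]; norm_num)
  let b := _root_.Basis.piTensorProduct fun i => Module.finBasis F (Q i).carrier
  have hrank : Module.finrank F (⨂[F] i, (Q i).carrier) = 4 ^ n := by
    rw [Module.finrank_eq_card_basis b]
    simp [(Q _).finrank_eq_four]
  have : FiniteDimensional F (⨂[F] i, (Q i).carrier) := b.finiteDimensional_of_finite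
  have : FiniteDimensional F A := Module.Finite.of_surjective f.toLinearMap hsurj
  have hle := h.four_pow_le_finrank
  rw [htop, subalgebra_top_finrank_eq_submodule_top_finrank, finrank_top, ← hrank] at hle
  have heq := le_antisymm hle (LinearMap.finrank_le_finrank_of_surjective (f := f.toLinearMap) hsurj)
  have hinj : Function.Injective f :=
    (LinearMap.injective_iff_surjective_of_finrank_eq_finrank (f := f.toLinearMap) heq).mpr hsurj
  refine ⟨n, Q, (AlgEquiv.ofBijective f ⟨hinj, hsurj⟩).symm, fun a => ?_⟩
  rw [AlgEquiv.symm_apply_eq]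
  have := piTensorLift_involution φ hφ (fun i => (Q i).inv) J (fun _ _ => rfl)
    ((AlgEquiv.ofBijective f ⟨hinj, hsurj⟩).symm a)
  refine Eq.trans ?_ this
  congr 1
  exact ((AlgEquiv.ofBijective f ⟨hinj, hsurj⟩).apply_symm_apply a).symm

end IsQuaternionFamily

/-- `B` is generated by a commuting family of quaternion pairs spanning `J`-stable subalgebras. -/
def IsQuaternionGenerated {F : Type u} {A : Type w} [Field F] [Ring A] [Algebra F A]
    (J : AlgInvolution F A) (B : Subalgebra F A) : Prop :=
  ∃ (n : ℕ) (u v : Fin n → A), IsQuaternionFamily J u v ∧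
    Algebra.adjoin F (⋃ i, ({u i, v i} : Set A)) = B

namespace IsQuaternionGenerated

variable {F : Type u} {A : Type w} [Field F] [Ring A] [Algebra F A] {J : AlgInvolution F A}

theorem bot : IsQuaternionGenerated J (⊥ : Subalgebra F A) :=
  ⟨0, Fin.elim0, Fin.elim0, ⟨fun i => i.elim0, fun i => i.elim0, fun i => i.elim0⟩, by simp⟩

theorem adjoin_sup {B : Subalgebra F A} (h : IsQuaternionGenerated J B) {a b : A}
    (hab : IsQuaternionPair F a b)
    (hJ : ∀ x ∈ ({a, b} : Set A), J.toLinearMap x ∈ Algebra.adjoin F {a, b})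
    (hc : ∀ x ∈ ({a, b} : Set A), ∀ y ∈ B, Commute x y) :
    IsQuaternionGenerated J (Algebra.adjoin F {a, b} ⊔ B) := by
  obtain ⟨n, u, v, huv, rfl⟩ := h
  refine ⟨n + 1, Fin.cons a u, Fin.cons b v, huv.cons hab hJ fun i x hx y hy =>
    hc x hx y (Algebra.subset_adjoin (Set.mem_iUnion_of_mem i hy)), ?_⟩
  rw [← Algebra.adjoin_union]
  congr 1
  ext x
  simp [Fin.exists_fin_succ]

end IsQuaternionGenerated

/-! ### The hyperbolic space of dimension four -/

/-- The relations between the images in the Clifford algebra of a basis `x, y, s, t` of a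
hyperbolic space of dimension four, with totally singular planes spanned by `x, y` and by `s, t`. -/
structure IsHyperbolicQuadruple {A : Type*} [Ring A] (x y s t : A) : Prop where
  xx : x * x = 0
  yy : y * y = 0
  ss : s * s = 0
  tt : t * t = 0
  yx : y * x = x * y
  ts : t * s = s * t
  sx : s * x = x * s
  ty : t * y = y * t
  tx : t * x = x * t + 1
  sy : s * y = y * s + 1

namespace IsHyperbolicQuadruple

theorem mul_mul_left {A : Type*} [Ring A] {a b c : A} (h : a * b = c) (z : A) :
    a * (b * z) = c * z := by
  rw [← mul_assoc, h]

variable {F : Type u} {A : Type w} [Field F] [Ring A] [Algebra F A] {x y s t : A}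

set_option linter.unusedSimpArgs false in
-- Commutators with `x` and `y` act on `F[s, t]` as `∂/∂t` and `∂/∂s`. New coordinates there are `u₁
-- = (1 + s)(1 + t) + 1` and `u₂ = s(1 + t)`, with inverse `t = u₁ + u₂`, `s = u₂(1 + t)`. The chain
-- rule suggests `v₁ = x + y u₂` and `v₂ = x + y(1 + u₁)` as the dual derivations, and the
-- involution then fixes `uᵢ` and sends `vᵢ` to `vᵢ + uᵢ + 1`. Each identity is checked by moving
-- `x, y` to the left of `s, t`; the remaining terms have even coefficients.
theorem relations [CharP A 2] (h : IsHyperbolicQuadruple x y s t) {u₁ v₁ u₂ v₂ : A}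
    (hu₁ : s + t + s * t = u₁) (hv₁ : x + y * s + y * (s * t) = v₁)
    (hu₂ : s + s * t = u₂) (hv₂ : x + y + y * s + y * t + y * (s * t) = v₂) :
    (u₁ * u₁ = 0 ∧ v₁ * v₁ = 0 ∧ u₁ * v₁ + v₁ * u₁ = 1) ∧
    (u₂ * u₂ = 0 ∧ v₂ * v₂ = 0 ∧ u₂ * v₂ + v₂ * u₂ = 1) ∧
    (u₁ * u₂ = u₂ * u₁ ∧ u₁ * v₂ = v₂ * u₁ ∧ v₁ * u₂ = u₂ * v₁ ∧ v₁ * v₂ = v₂ * v₁) ∧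
    (s + t + t * s = u₁ ∧ x + s + s * (y + t) + t * s * (y + t) = v₁ + u₁ + 1) ∧
    (s + t * s = u₂ ∧ x + s + (y + t) + s * (y + t) + t * (y + t) + t * s * (y + t) =
      v₂ + u₂ + 1) ∧
    u₁ + u₂ = t ∧ u₂ * (1 + t) = s ∧ (v₁ + v₂) * (1 + t) = y ∧ v₁ + y * u₂ = x := by
  subst hu₁ hv₁ hu₂ hv₂
  have four_zsmul (z : A) : (4 : ℤ) • z = 0 := by
    rw [show (4 : ℤ) = 2 * 2 by norm_num, mul_smul, CharTwo.two_zsmul]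
  have six_zsmul (z : A) : (6 : ℤ) • z = 0 := by
    rw [show (6 : ℤ) = 2 * 3 by norm_num, mul_smul, CharTwo.two_zsmul]
  refine ⟨⟨?_, ?_, ?_⟩, ⟨?_, ?_, ?_⟩, ⟨?_, ?_, ?_, ?_⟩, ⟨?_, ?_⟩, ⟨?_, ?_⟩, ?_, ?_, ?_, ?_⟩ <;>
  · rw [← CharTwo.add_eq_zero]
    try simp only [mul_add, add_mul, mul_assoc, h.xx, h.yy, h.ss, h.tt, h.yx, h.ts, h.sx, h.ty, h.tx,
      h.sy, mul_mul_left h.xx, mul_mul_left h.yy, mul_mul_left h.ss, mul_mul_left h.tt,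
      mul_mul_left h.yx, mul_mul_left h.ts, mul_mul_left h.sx, mul_mul_left h.ty,
      mul_mul_left h.tx, mul_mul_left h.sy, one_mul, mul_one, zero_mul, mul_zero, add_zero,
      zero_add]
    try abel_nf
    try simp only [CharTwo.two_zsmul, four_zsmul, six_zsmul, add_zero, zero_add]

/-- The subalgebra generated by a hyperbolic quadruple, with the involution given by `x ↦ x + s`,
`y ↦ y + t`, `s ↦ s`, `t ↦ t`, is generated by two commuting stable quaternion pairs. -/
theorem isQuaternionGenerated [CharP A 2] (h : IsHyperbolicQuadruple x y s t)
    {J : AlgInvolution F A} (hx : J.toLinearMap x = x + s) (hy : J.toLinearMap y = y + t)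
    (hs : J.toLinearMap s = s) (ht : J.toLinearMap t = t) {B : Subalgebra F A}
    (hB : IsQuaternionGenerated J B)
    (hc : ∀ a ∈ ({x, y, s, t} : Set A), ∀ b ∈ B, Commute a b) :
    IsQuaternionGenerated J (Algebra.adjoin F {x, y, s, t} ⊔ B) := by
  obtain ⟨u₁, hu₁⟩ : ∃ u, s + t + s * t = u := ⟨_, rfl⟩
  obtain ⟨v₁, hv₁⟩ : ∃ v, x + y * s + y * (s * t) = v := ⟨_, rfl⟩
  obtain ⟨u₂, hu₂⟩ : ∃ u, s + s * t = u := ⟨_, rfl⟩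
  obtain ⟨v₂, hv₂⟩ : ∃ v, x + y + y * s + y * t + y * (s * t) = v := ⟨_, rfl⟩
  obtain ⟨⟨huu₁, hvv₁, huv₁⟩, ⟨huu₂, hvv₂, huv₂⟩, ⟨c₁, c₂, c₃, c₄⟩, ⟨hJu₁, hJv₁⟩, ⟨hJu₂, hJv₂⟩,
    gt, gs, gy, gx⟩ := h.relations hu₁ hv₁ hu₂ hv₂
  replace hJu₁ : J.toLinearMap u₁ = u₁ := by
    rw [← hu₁]
    simp only [map_add, J.map_mul', hs, ht]
    rw [hJu₁, hu₁]
  replace hJu₂ : J.toLinearMap u₂ = u₂ := by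
    rw [← hu₂]
    simp only [map_add, J.map_mul', hs, ht]
    rw [hJu₂, hu₂]
  replace hJv₁ : J.toLinearMap v₁ = v₁ + u₁ + 1 := by
    rw [← hJv₁, ← hv₁]
    simp only [map_add, J.map_mul', hx, hy, hs, ht]
  replace hJv₂ : J.toLinearMap v₂ = v₂ + u₂ + 1 := by
    rw [← hJv₂, ← hv₂]
    simp only [map_add, J.map_mul', hx, hy, hs, ht]
  have hJ {u v : A} (hu : J.toLinearMap u = u) (hv : J.toLinearMap v = v + u + 1) :
      ∀ z ∈ ({u, v} : Set A), J.toLinearMap z ∈ Algebra.adjoin F {u, v} := by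
    have mu : u ∈ Algebra.adjoin F {u, v} := Algebra.subset_adjoin (by simp)
    have mv : v ∈ Algebra.adjoin F {u, v} := Algebra.subset_adjoin (by simp)
    rintro z (rfl | rfl)
    · rw [hu]; exact mu
    · rw [hv]; exact add_mem (add_mem mv mu) (one_mem _)
  have mx : x ∈ Algebra.adjoin F {x, y, s, t} := Algebra.subset_adjoin (by simp)
  have my : y ∈ Algebra.adjoin F {x, y, s, t} := Algebra.subset_adjoin (by simp)
  have ms : s ∈ Algebra.adjoin F {x, y, s, t} := Algebra.subset_adjoin (by simp)
  have mt : t ∈ Algebra.adjoin F {x, y, s, t} := Algebra.subset_adjoin (by simp)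
  have hu₁m : u₁ ∈ Algebra.adjoin F {x, y, s, t} :=
    hu₁ ▸ add_mem (add_mem ms mt) (mul_mem ms mt)
  have hv₁m : v₁ ∈ Algebra.adjoin F {x, y, s, t} :=
    hv₁ ▸ add_mem (add_mem mx (mul_mem my ms)) (mul_mem my (mul_mem ms mt))
  have hu₂m : u₂ ∈ Algebra.adjoin F {x, y, s, t} := hu₂ ▸ add_mem ms (mul_mem ms mt)
  have hv₂m : v₂ ∈ Algebra.adjoin F {x, y, s, t} :=
    hv₂ ▸ add_mem (add_mem (add_mem (add_mem mx my) (mul_mem my ms)) (mul_mem my mt))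
      (mul_mem my (mul_mem ms mt))
  have hcB {a b : A} (ha : a ∈ Algebra.adjoin F {x, y, s, t}) (hb : b ∈ B) : Commute a b :=
    (Algebra.commute_of_mem_adjoin_of_forall_mem_commute ha fun z hz => (hc z hz b hb).symm).symm
  have h₂ := hB.adjoin_sup (a := u₂) (b := v₂) ⟨⟨0, by simpa using huu₂⟩, ⟨0, by simpa using hvv₂⟩,
    huv₂⟩ (hJ hJu₂ hJv₂) (by rintro z (rfl | rfl) b hb <;> exact hcB ‹_› hb)
  have h₁ := h₂.adjoin_sup (a := u₁) (b := v₁) ⟨⟨0, by simpa using huu₁⟩, ⟨0, by simpa using hvv₁⟩,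
    huv₁⟩ (hJ hJu₁ hJv₁) (by
      intro z hz b hb
      rw [← Algebra.adjoin_eq B, ← Algebra.adjoin_union] at hb
      refine Algebra.commute_of_mem_adjoin_of_forall_mem_commute hb ?_
      rcases hz with rfl | rfl
      · rintro b ((rfl | rfl) | hb)
        exacts [c₁, c₂, hcB hu₁m hb]
      · rintro b ((rfl | rfl) | hb)
        exacts [c₃, c₄, hcB hv₁m hb])
  convert h₁ using 1
  rw [← sup_assoc]
  congr 1
  -- The inverse coordinate formulas recover `t`, `s`, `y`, `x`, in this order, from the two pairs.
  refine le_antisymm (Algebra.adjoin_le ?_) (sup_le (Algebra.adjoin_le ?_) (Algebra.adjoin_le ?_))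
  · rw [← Algebra.adjoin_union]
    have nu₁ : u₁ ∈ Algebra.adjoin F ({u₁, v₁} ∪ {u₂, v₂}) := Algebra.subset_adjoin (by simp)
    have nv₁ : v₁ ∈ Algebra.adjoin F ({u₁, v₁} ∪ {u₂, v₂}) := Algebra.subset_adjoin (by simp)
    have nu₂ : u₂ ∈ Algebra.adjoin F ({u₁, v₁} ∪ {u₂, v₂}) := Algebra.subset_adjoin (by simp)
    have nv₂ : v₂ ∈ Algebra.adjoin F ({u₁, v₁} ∪ {u₂, v₂}) := Algebra.subset_adjoin (by simp)
    have nt : t ∈ Algebra.adjoin F ({u₁, v₁} ∪ {u₂, v₂}) := gt ▸ add_mem nu₁ nu₂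
    have ns : s ∈ Algebra.adjoin F ({u₁, v₁} ∪ {u₂, v₂}) :=
      gs ▸ mul_mem nu₂ (add_mem (one_mem _) nt)
    have ny : y ∈ Algebra.adjoin F ({u₁, v₁} ∪ {u₂, v₂}) :=
      gy ▸ mul_mem (add_mem nv₁ nv₂) (add_mem (one_mem _) nt)
    have nx : x ∈ Algebra.adjoin F ({u₁, v₁} ∪ {u₂, v₂}) := gx ▸ add_mem nv₁ (mul_mem ny nu₂)
    rintro z (rfl | rfl | rfl | rfl) <;> assumption
  · rintro z (rfl | rfl) <;> assumption
  · rintro z (rfl | rfl) <;> assumption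

end IsHyperbolicQuadruple

/-! ### Splitting a quadratic space with an isometric involution -/

theorem nontrivial_cliffordAlgebra {F : Type u} {V : Type v} [Field F] [AddCommGroup V]
    [Module F V] (q : QuadraticForm F V) : Nontrivial (CliffordAlgebra q) := by
  -- In any characteristic a quadratic form over a field comes from a bilinear form, not necessarily
  -- symmetric; this makes `C(q)` linearly isomorphic to the exterior algebra.
  obtain ⟨B, hB⟩ := LinearMap.BilinMap.toQuadraticMap_surjective (R := F) (M := V) (N := F) (-q)
  have h : B.toQuadraticMap = 0 - q := by rw [hB, zero_sub]
  have : Nontrivial (CliffordAlgebra (0 : QuadraticForm F V)) :=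
    inferInstanceAs (Nontrivial (ExteriorAlgebra F V))
  exact (CliffordAlgebra.changeFormEquiv h).toEquiv.nontrivial

section CliffordDecomposition

open QuadraticMap CliffordAlgebra

variable {F : Type u} {V : Type v} [Field F] [AddCommGroup V] [Module F V]
  {q : QuadraticForm F V} {τ : q.IsometryEquiv q}

theorem polar_isometryEquiv (τ : q.IsometryEquiv q) (x y : V) :
    polar q (τ x) (τ y) = polar q x y := by
  simp only [polar, ← map_add, τ.map_app]

/-- A submodule is nondegenerate and stable under an isometry. -/
structure IsNondegenerateStable (τ : q.IsometryEquiv q) (U : Submodule F V) : Prop where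
  stable : ∀ z ∈ U, τ z ∈ U
  nondegenerate : ∀ z ∈ U, (∀ w ∈ U, polar q z w = 0) → z = 0

/-- The vectors of `U` orthogonal to `S`. -/
def orthogonalIn (q : QuadraticForm F V) (U : Submodule F V) (S : Set V) : Submodule F V where
  carrier := {z | z ∈ U ∧ ∀ w ∈ S, polar q z w = 0}
  add_mem' := fun ⟨h₁, h₂⟩ ⟨h₃, h₄⟩ =>
    ⟨add_mem h₁ h₃, fun w hw => by rw [polar_add_left, h₂ w hw, h₄ w hw, add_zero]⟩
  zero_mem' := ⟨zero_mem _, fun w _ => polar_zero_left _ w⟩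
  smul_mem' := fun r _ ⟨h₁, h₂⟩ =>
    ⟨U.smul_mem r h₁, fun w hw => by rw [polar_smul_left, h₂ w hw, smul_zero]⟩

theorem polar_eq_zero_of_mem_span {S : Set V} {z : V} (h : ∀ w ∈ S, polar q z w = 0) {w : V}
    (hw : w ∈ Submodule.span F S) : polar q z w = 0 := by
  induction hw using Submodule.span_induction with
  | mem w hw => exact h w hw
  | zero => exact polar_zero_right _ z
  | add a b _ _ ha hb => rw [polar_add_right, ha, hb, add_zero]
  | smul r a _ ha => rw [polar_smul_right, ha, smul_zero]

/-- Stability uses `b(τz, w) = b(z, τw)`. A vector of the complement orthogonal to the complement is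
also orthogonal to `S`, hence to all of `U` by `hdec`. -/
theorem IsNondegenerateStable.inf_orthogonal {U : Submodule F V} (hU : IsNondegenerateStable τ U)
    (hτ : ∀ x, τ (τ x) = x) {S : Set V} (hSτ : ∀ x ∈ S, τ x ∈ Submodule.span F S)
    (hdec : ∀ z ∈ U, ∃ w ∈ Submodule.span F S, z - w ∈ orthogonalIn q U S) :
    IsNondegenerateStable τ (orthogonalIn q U S) where
  stable z hz := by
    refine ⟨hU.stable z hz.1, fun w hw => ?_⟩
    rw [← polar_isometryEquiv τ, hτ]
    exact polar_eq_zero_of_mem_span hz.2 (hSτ w hw)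
  nondegenerate z hz h := by
    refine hU.nondegenerate z hz.1 fun y hy => ?_
    obtain ⟨w, hw, hyw⟩ := hdec y hy
    rw [← add_sub_cancel w y, polar_add_right, h _ hyw, polar_eq_zero_of_mem_span hz.2 hw, add_zero]

theorem IsNondegenerateStable.inf_orthogonal_lt {U : Submodule F V}
    (hU : IsNondegenerateStable τ U) {S : Set V} (hSU : S ⊆ U)
    {x : V} (hx : x ∈ S) (hx0 : x ≠ 0) : orthogonalIn q U S < U := by
  refine lt_of_le_of_ne (fun z hz => hz.1) fun heq => hx0 ?_
  refine hU.nondegenerate x (hSU hx) fun y hy => ?_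
  rw [polar_comm]
  exact (heq.ge hy).2 x hx

theorem adjoin_ι_eq_sup {U : Submodule F V} {S : Set V} (hSU : S ⊆ U)
    (hdec : ∀ z ∈ U, ∃ w ∈ Submodule.span F S, z - w ∈ orthogonalIn q U S) :
    Algebra.adjoin F (ι q '' U) =
      Algebra.adjoin F (ι q '' S) ⊔ Algebra.adjoin F (ι q '' orthogonalIn q U S) := by
  refine le_antisymm (Algebra.adjoin_le ?_) (sup_le (Algebra.adjoin_mono (Set.image_mono hSU))
    (Algebra.adjoin_mono (Set.image_mono fun z hz => hz.1)))
  rintro _ ⟨z, hz, rfl⟩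
  obtain ⟨w, hw, hzw⟩ := hdec z hz
  rw [← add_sub_cancel w z, map_add]
  refine add_mem ((le_sup_left : Algebra.adjoin F (ι q '' S) ≤ _) ?_)
    ((le_sup_right : Algebra.adjoin F (ι q '' orthogonalIn q U S) ≤ _)
      (Algebra.subset_adjoin ⟨_, hzw, rfl⟩))
  have : Submodule.span F S ≤
      (Subalgebra.toSubmodule (Algebra.adjoin F (ι q '' S))).comap (ι q) :=
    Submodule.span_le.mpr fun x hx => Algebra.subset_adjoin ⟨x, hx, rfl⟩
  exact this hw

variable [CharP F 2]

theorem polar_self_eq_zero (q : QuadraticForm F V) (x : V) : polar q x x = 0 := by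
  rw [polar_self, CharTwo.two_nsmul]

theorem ι_mul_ι_swap (x y : V) :
    ι q y * ι q x = ι q x * ι q y + algebraMap F _ (polar q x y) := by
  rw [← ι_mul_ι_add_swap, ← add_assoc, module_add_self F, zero_add]

/-- Splitting off the span of `S` from a nondegenerate stable submodule `U`. -/
theorem IsNondegenerateStable.isQuaternionGenerated_of_split {U : Submodule F V}
    (hU : IsNondegenerateStable τ U) (hτ : ∀ x, τ (τ x) = x) {J : AlgInvolution F (CliffordAlgebra q)}
    (ih : ∀ U' < U, IsNondegenerateStable τ U' →
      IsQuaternionGenerated J (Algebra.adjoin F (ι q '' U')))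
    {S : Set V} (hSU : S ⊆ U) (hSτ : ∀ x ∈ S, τ x ∈ Submodule.span F S)
    (hdec : ∀ z ∈ U, ∃ w ∈ Submodule.span F S, ∀ x ∈ S, polar q (z - w) x = 0)
    {x : V} (hx : x ∈ S) (hx0 : x ≠ 0)
    (hstep : ∀ B, IsQuaternionGenerated J B → (∀ a ∈ ι q '' S, ∀ b ∈ B, Commute a b) →
      IsQuaternionGenerated J (Algebra.adjoin F (ι q '' S) ⊔ B)) :
    IsQuaternionGenerated J (Algebra.adjoin F (ι q '' U)) := by
  replace hdec : ∀ z ∈ U, ∃ w ∈ Submodule.span F S, z - w ∈ orthogonalIn q U S := by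
    intro z hz
    obtain ⟨w, hw, h⟩ := hdec z hz
    exact ⟨w, hw, sub_mem hz (Submodule.span_le.mpr hSU hw), h⟩
  rw [adjoin_ι_eq_sup hSU hdec]
  refine hstep _ (ih _ (hU.inf_orthogonal_lt hSU hx hx0) (hU.inf_orthogonal hτ hSτ hdec)) ?_
  rintro _ ⟨a, ha, rfl⟩ b hb
  refine Algebra.commute_of_mem_adjoin_of_forall_mem_commute hb ?_
  rintro _ ⟨z, hz, rfl⟩
  refine (ι_mul_ι_swap z a).trans ?_
  rw [hz.2 a ha, map_zero, add_zero]

/-- Splitting off a stable plane. -/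
theorem IsNondegenerateStable.isQuaternionGenerated_of_plane {U : Submodule F V}
    (hU : IsNondegenerateStable τ U) (hτ : ∀ x, τ (τ x) = x)
    (ih : ∀ U' < U, IsNondegenerateStable τ U' →
      IsQuaternionGenerated (cliffordInvolution τ hτ) (Algebra.adjoin F (ι q '' U')))
    {x y : V} (hx : x ∈ U) (hy : y ∈ U) (hxy : polar q x y = 1)
    (hxτ : τ x ∈ Submodule.span F {x, y}) (hyτ : τ y ∈ Submodule.span F {x, y}) :
    IsQuaternionGenerated (cliffordInvolution τ hτ) (Algebra.adjoin F (ι q '' U)) := by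
  have hyx : polar q y x = 1 := by rw [polar_comm, hxy]
  have hτS : ∀ z ∈ ({x, y} : Set V), τ z ∈ Submodule.span F {x, y} := by
    rintro z (rfl | rfl) <;> assumption
  refine hU.isQuaternionGenerated_of_split hτ ih (S := {x, y}) ?_ hτS ?_ (x := x) (by simp) ?_ ?_
  · rintro z (rfl | rfl) <;> assumption
  · intro z _
    -- Projection onto the plane: the dual basis of `x, y` is `y, x`, without signs in
    -- characteristic 2.
    refine ⟨polar q z y • x + polar q z x • y, Submodule.mem_span_pair.mpr ⟨_, _, rfl⟩, ?_⟩
    rintro w (rfl | rfl) <;>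
      simp [polar_sub_left, polar_add_left, polar_smul_left, CharTwo.two_eq_zero, hxy, hyx]
  · rintro rfl
    simp at hxy
  · intro B hB hc
    rw [Set.image_pair] at hc ⊢
    refine hB.adjoin_sup ⟨⟨_, ι_sq_scalar q x⟩, ⟨_, ι_sq_scalar q y⟩, ?_⟩ ?_ hc
    · rw [ι_mul_ι_add_swap, hxy, map_one]
    · have : Submodule.span F {x, y} ≤
          (Subalgebra.toSubmodule (Algebra.adjoin F {ι q x, ι q y})).comap (ι q) :=
        Submodule.span_le.mpr (by
          rintro z (rfl | rfl) <;> exact Algebra.subset_adjoin (by simp))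
      rintro z (rfl | rfl) <;> rw [cliffordInvolution_ι]
      exacts [this hxτ, this hyτ]

/-- Splitting off a stable hyperbolic space of dimension four on which `τ - 1` has rank two. -/
theorem IsNondegenerateStable.isQuaternionGenerated_of_quadruple {U : Submodule F V}
    (hU : IsNondegenerateStable τ U) (hτ : ∀ x, τ (τ x) = x)
    (ih : ∀ U' < U, IsNondegenerateStable τ U' →
      IsQuaternionGenerated (cliffordInvolution τ hτ) (Algebra.adjoin F (ι q '' U')))
    {x y s t : V} (hx : x ∈ U) (hy : y ∈ U) (hs : s ∈ U) (ht : t ∈ U)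
    (hτx : τ x = x + s) (hτy : τ y = y + t) (hτs : τ s = s) (hτt : τ t = t)
    (qx : q x = 0) (qy : q y = 0) (qs : q s = 0) (qt : q t = 0)
    (xy : polar q x y = 0) (st : polar q s t = 0) (xs : polar q x s = 0) (yt : polar q y t = 0)
    (xt : polar q x t = 1) (ys : polar q y s = 1) :
    IsQuaternionGenerated (cliffordInvolution τ hτ) (Algebra.adjoin F (ι q '' U)) := by
  have := nontrivial_cliffordAlgebra q
  have : CharP (CliffordAlgebra q) 2 :=
    charP_of_injective_algebraMap (algebraMap F (CliffordAlgebra q)).injective 2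
  have yx : polar q y x = 0 := by rw [polar_comm, xy]
  have ts : polar q t s = 0 := by rw [polar_comm, st]
  have sx : polar q s x = 0 := by rw [polar_comm, xs]
  have ty : polar q t y = 0 := by rw [polar_comm, yt]
  have tx : polar q t x = 1 := by rw [polar_comm, xt]
  have sy : polar q s y = 1 := by rw [polar_comm, ys]
  have mx : x ∈ Submodule.span F {x, y, s, t} := Submodule.subset_span (by simp)
  have my : y ∈ Submodule.span F {x, y, s, t} := Submodule.subset_span (by simp)
  have ms : s ∈ Submodule.span F {x, y, s, t} := Submodule.subset_span (by simp)
  have mt : t ∈ Submodule.span F {x, y, s, t} := Submodule.subset_span (by simp)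
  refine hU.isQuaternionGenerated_of_split hτ ih (S := {x, y, s, t}) ?_ ?_ ?_ (x := x)
    (by simp) ?_ ?_
  · rintro z (rfl | rfl | rfl | rfl) <;> assumption
  · rintro z (rfl | rfl | rfl | rfl)
    exacts [hτx ▸ add_mem mx ms, hτy ▸ add_mem my mt, hτs.symm ▸ ms, hτt.symm ▸ mt]
  · intro z _
    -- The form pairs `x` with `t` and `y` with `s`, so each coefficient is the polar value against
    -- the partner.
    refine ⟨polar q z t • x + polar q z s • y + polar q z y • s + polar q z x • t,
      add_mem (add_mem (add_mem (Submodule.smul_mem _ _ mx) (Submodule.smul_mem _ _ my))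
        (Submodule.smul_mem _ _ ms)) (Submodule.smul_mem _ _ mt), ?_⟩
    rintro w (rfl | rfl | rfl | rfl) <;>
      simp [polar_sub_left, polar_add_left, polar_smul_left, *]
  · rintro rfl
    simp at xt
  · intro B hB hc
    have himg : ι q '' {x, y, s, t} = {ι q x, ι q y, ι q s, ι q t} := by
      simp [Set.image_insert_eq]
    rw [himg] at hc ⊢
    refine IsHyperbolicQuadruple.isQuaternionGenerated ?_ ?_ ?_ ?_ ?_ hB hc
    · constructor <;> simp [ι_mul_ι_swap x y, ι_mul_ι_swap s t, ι_mul_ι_swap x s,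
        ι_mul_ι_swap y t, ι_mul_ι_swap x t, ι_mul_ι_swap y s, *]
    all_goals rw [cliffordInvolution_ι]
    · rw [hτx, map_add]
    · rw [hτy, map_add]
    · rw [hτs]
    · rw [hτt]

/-- The map `N = 1 + τ` is self-adjoint with `N² = 0`, so its image is totally isotropic; it is
totally singular since `q(Nz) = b(z, τz) = 0`. Adding vectors of the image changes neither `N` nor
the pairings with the image, which leaves room to normalize `x` and `y`. -/
theorem IsNondegenerateStable.isQuaternionGenerated_of_forall_polar_eq_zero {U : Submodule F V}
    (hU : IsNondegenerateStable τ U) (hτ : ∀ x, τ (τ x) = x)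
    (ih : ∀ U' < U, IsNondegenerateStable τ U' →
      IsQuaternionGenerated (cliffordInvolution τ hτ) (Algebra.adjoin F (ι q '' U')))
    (hpol : ∀ x ∈ U, polar q x (τ x) = 0) {x : V} (hx : x ∈ U) (hxτ : τ x ≠ x) :
    IsQuaternionGenerated (cliffordInvolution τ hτ) (Algebra.adjoin F (ι q '' U)) := by
  have add_self (z : V) : z + z = 0 := module_add_self F z
  let N (z : V) : V := z + τ z
  have hNU {z : V} (hz : z ∈ U) : N z ∈ U := add_mem hz (hU.stable z hz)
  have hτN (z : V) : τ z = z + N z := by rw [← add_assoc, add_self, zero_add]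
  have hNτ (z : V) : τ (N z) = N z := by simp only [N, map_add, hτ, add_comm]
  have hNN (z : V) : N (N z) = 0 := by
    change N z + τ (N z) = 0
    rw [hNτ, add_self]
  have hNadd (z w : V) (r : F) : N (z + r • N w) = N z := by
    have h : N (z + r • N w) = N z + r • N (N w) := by
      simp only [N, map_add, map_smul, smul_add]
      abel
    rw [h, hNN, smul_zero, add_zero]
  have polar_N (z w : V) : polar q z (N w) = polar q (N z) w := by
    simp only [N, polar_add_left, polar_add_right]
    rw [← polar_isometryEquiv τ z (τ w), hτ]
  have polar_self_N {z : V} (hz : z ∈ U) : polar q z (N z) = 0 := by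
    simp only [N, polar_add_right, polar_self_eq_zero, hpol z hz, add_zero]
  have polar_N_N (z w : V) : polar q (N z) (N w) = 0 := by
    rw [polar_N, hNN, polar_zero_left]
  have q_N {z : V} (hz : z ∈ U) : q (N z) = 0 := by
    simp only [N]
    rw [QuadraticMap.map_add q, τ.map_app, hpol z hz, CharTwo.add_self_eq_zero, add_zero]
  have hNx : N x ≠ 0 := by
    intro h
    exact hxτ (by rw [hτN, h, add_zero])
  obtain ⟨y₀, hy₀, hxy₀⟩ : ∃ y ∈ U, polar q (N x) y ≠ 0 := by
    by_contra! H
    exact hNx (hU.nondegenerate _ (hNU hx) H)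
  obtain ⟨y, hy, hxy⟩ : ∃ y ∈ U, polar q (N x) y = 1 :=
    ⟨(polar q (N x) y₀)⁻¹ • y₀, U.smul_mem _ hy₀, by
      rw [polar_smul_right, smul_eq_mul, inv_mul_cancel₀ hxy₀]⟩
  have hxy' : polar q x (N y) = 1 := by rw [polar_N, hxy]
  -- As `b(x, Ny) = 1`, a multiple of `Ny` makes `y` orthogonal to `x`.
  have key : ∃ y₁ ∈ U, N y₁ = N y ∧ polar q x y₁ = 0 := by
    refine ⟨y + polar q x y • N y, add_mem hy (U.smul_mem _ (hNU hy)), hNadd _ _ _, ?_⟩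
    rw [polar_add_right, polar_smul_right, hxy', smul_eq_mul, mul_one, CharTwo.add_self_eq_zero]
  obtain ⟨y₁, hy₁, hNy₁, hxy₁⟩ := key
  -- Since `q(x + c Ny) = q(x) + c`, taking `c = q(x)` makes the vector singular; likewise for `y₁`
  -- with `Nx`.
  have hx2 : x + q x • N y ∈ U := add_mem hx (U.smul_mem _ (hNU hy))
  have hy2 : y₁ + q y₁ • N x ∈ U := add_mem hy₁ (U.smul_mem _ (hNU hx))
  have e1 : polar q y₁ (N x) = 1 := by rw [polar_N, hNy₁, polar_comm, hxy']
  have e2 : polar q y₁ (N y) = 0 := by rw [← hNy₁, polar_self_N hy₁]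
  have e3 : polar q (N y) y₁ = 0 := by rw [polar_comm, e2]
  refine hU.isQuaternionGenerated_of_quadruple hτ ih hx2 hy2 (hNU hx) (hNU hy) ?_ ?_ (hNτ x)
    (hNτ y) ?_ ?_ (q_N hx) (q_N hy) ?_ (polar_N_N x y) ?_ ?_ ?_ ?_
  · rw [hτN, hNadd]
  · rw [hτN, hNadd, hNy₁]
  · rw [QuadraticMap.map_add q, QuadraticMap.map_smul, q_N hy, polar_smul_right, hxy', smul_zero,
      smul_eq_mul, mul_one, add_zero, CharTwo.add_self_eq_zero]
  · rw [QuadraticMap.map_add q, QuadraticMap.map_smul, q_N hx, polar_smul_right, e1, smul_zero,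
      smul_eq_mul, mul_one, add_zero, CharTwo.add_self_eq_zero]
  all_goals simp [polar_add_left, polar_add_right, polar_smul_left, polar_smul_right, polar_N_N,
    polar_self_N hx, hxy', hxy₁, e1, e2, e3]

theorem IsNondegenerateStable.isQuaternionGenerated [FiniteDimensional F V]
    (hτ : ∀ x, τ (τ x) = x) (U : Submodule F V) (hU : IsNondegenerateStable τ U) :
    IsQuaternionGenerated (cliffordInvolution τ hτ) (Algebra.adjoin F (ι q '' U)) := by
  induction U using WellFoundedLT.induction with
  | ind U ih =>
    by_cases h₁ : ∃ x ∈ U, polar q x (τ x) ≠ 0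
    · obtain ⟨x, hx, hxτ⟩ := h₁
      -- `τ` swaps the lines of `x` and `τx`; rescaling `τx` normalizes the pairing to 1.
      refine hU.isQuaternionGenerated_of_plane hτ ih hx
        (U.smul_mem (polar q x (τ x))⁻¹ (hU.stable x hx)) ?_ ?_ ?_
      · rw [polar_smul_right, smul_eq_mul, inv_mul_cancel₀ hxτ]
      · exact Submodule.mem_span_pair.mpr ⟨0, polar q x (τ x), by
          rw [zero_smul, zero_add, smul_smul, mul_inv_cancel₀ hxτ, one_smul]⟩
      · exact Submodule.mem_span_pair.mpr ⟨(polar q x (τ x))⁻¹, 0, by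
          rw [zero_smul, add_zero, map_smul, hτ]⟩
    push Not at h₁
    by_cases h₂ : ∃ x ∈ U, τ x ≠ x
    · obtain ⟨x, hx, hxτ⟩ := h₂
      exact hU.isQuaternionGenerated_of_forall_polar_eq_zero hτ ih h₁ hx hxτ
    push Not at h₂
    by_cases h₃ : ∃ x ∈ U, x ≠ 0
    · obtain ⟨x, hx, hx0⟩ := h₃
      obtain ⟨y, hy, hxy⟩ : ∃ y ∈ U, polar q x y ≠ 0 := by
        by_contra! H
        exact hx0 (hU.nondegenerate _ hx H)
      refine hU.isQuaternionGenerated_of_plane hτ ih hx (U.smul_mem (polar q x y)⁻¹ hy) ?_ ?_ ?_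
      · rw [polar_smul_right, smul_eq_mul, inv_mul_cancel₀ hxy]
      · rw [h₂ x hx]
        exact Submodule.subset_span (by simp)
      · rw [h₂ _ (U.smul_mem _ hy)]
        exact Submodule.subset_span (by simp)
    · push Not at h₃
      convert IsQuaternionGenerated.bot
      rw [eq_bot_iff, Algebra.adjoin_le_iff]
      rintro _ ⟨x, hx, rfl⟩
      rw [h₃ x hx, map_zero]
      exact zero_mem _

end CliffordDecomposition

theorem lemma4p6 {F : Type u} {V : Type v} [Field F] [CharP F 2]
    [AddCommGroup V] [Module F V] [FiniteDimensional F V]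
    (q : QuadraticForm F V) (hq : q.polarBilin.Nondegenerate)
    (τ : q.IsometryEquiv q) (hτ : ∀ x, τ (τ x) = x) :
    (cliffordInvolution τ hτ).IsTotallyDecomposable := by
  have := nontrivial_cliffordAlgebra q
  have htop : IsNondegenerateStable τ (⊤ : Submodule F V) :=
    ⟨fun _ _ => trivial, fun z _ h => hq.1 z fun w => h w trivial⟩
  obtain ⟨n, u, v, huv, hgen⟩ := IsNondegenerateStable.isQuaternionGenerated hτ ⊤ htop
  refine huv.isTotallyDecomposable ?_
  rw [hgen, Submodule.top_coe, Set.image_univ, CliffordAlgebra.adjoin_range_ι]
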